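/- A continuum is a connected compact metrizable space with more than one point; a subcontinuum of a continuum $Y$ is a non-empty compact connected subset of $Y$ (one-point sets are allowed). The meager composant of a point $x\in Y$ is the union of all nowhere dense subcontinua of $Y$ that contain $x$. A connected space $Z$ is *indecomposable* if it is not the union of two proper closed connected subsets. It is *strongly indecomposable* if for every two non-empty disjoint open sets $U,V\subseteq Z$ there are disjoint closed sets $A,B\subseteq Z$ with $Z\setminus U=A\cup B$, $A\cap V\neq\emptyset$ and $B\cap V\neq\emptyset$. It is *irreducible* if there are points $p,q\in Z$ such that no proper closed connected subset of $Z$ contains both $p$ and $q$. A connected subset $X$ of $Y$ is *singular with respect to* $y\in Y$ if every connected set $C\subseteq X$ whose closure in $Y$ contains $y$ is dense in $X$. Let $Y$ be a continuum and let $X$ be a meager composant of $Y$ (that is, the meager composant of some point of $Y$) that is dense in $Y$. Then the following are equivalent (subsets of $Y$ carry the subspace topology): 1. $X$ is indecomposable; 2. $X$ is strongly indecomposable; 3. there exists $y\in Y$ such that $X$ is singular with respect to $y$; 4. $Y\setminus X\neq\emptyset$ and $X$ is singular with respect to each point of $Y\setminus X$; 5. there exists $y\in Y$ such that the connected set $X\cup\{y\}$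 is irreducible; 6. $Y\setminus X\neq\emptyset$ and $X\cup\{y\}$ is irreducible for every $y\in Y\setminus X$; 7. $X\cup\{y\}$ is indecomposable for every $y\in Y$. -/

import Mathlib

namespace ContinuumTheory

/-- A connected space is indecomposable if it is not the union of two proper closed connected
subsets. -/
def IsIndecomposable (Z : Type*) [TopologicalSpace Z] : Prop :=
  ConnectedSpace Z ∧
    ¬ ∃ H K : Set Z, IsClosed H ∧ IsConnected H ∧ H ≠ Set.univ ∧
      IsClosed K ∧ IsConnected K ∧ K ≠ Set.univ ∧ H ∪ K = Set.univ

/-- A connected space is strongly indecomposable if for any two non-empty disjoint open sets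
`U` and `V`, the complement of `U` is the union of two disjoint closed sets that both meet `V`. -/
def IsStronglyIndecomposable (Z : Type*) [TopologicalSpace Z] : Prop :=
  ConnectedSpace Z ∧
    ∀ U V : Set Z, IsOpen U → IsOpen V → U.Nonempty → V.Nonempty → Disjoint U V →
      ∃ A B : Set Z, IsClosed A ∧ IsClosed B ∧ Disjoint A B ∧ Uᶜ = A ∪ B ∧
        (A ∩ V).Nonempty ∧ (B ∩ V).Nonempty

/-- A connected space is irreducible if there are two points `p` and `q` such that no proper closed
connected subset contains both. This is unrelated to the notion of algebraic geometry. -/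
def IsIrreducibleConnected (Z : Type*) [TopologicalSpace Z] : Prop :=
  ConnectedSpace Z ∧
    ∃ p q : Z, ∀ C : Set Z, IsClosed C → IsConnected C → p ∈ C → q ∈ C → C = Set.univ

/-- Subcontinua are the non-empty compact connected subsets; one-point sets are allowed. -/
def IsSubcontinuum {Y : Type*} [TopologicalSpace Y] (K : Set Y) : Prop :=
  IsCompact K ∧ IsConnected K

/-- The meager composant of `x`: the union of all nowhere dense subcontinua that contain `x`. -/
def meagerComposant {Y : Type*} [TopologicalSpace Y] (x : Y) : Set Y :=
  ⋃₀ {K : Set Y | IsSubcontinuum K ∧ IsNowhereDense K ∧ x ∈ K}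

/-- A connected subset `X` of `Y` is singular with respect to `y : Y` if every connected `C ⊆ X`
whose closure in `Y` contains `y` is dense in `X`. Here `closure` is the closure in `Y`, and
`closure C ∩ X` is the closure of `C` in the subspace `X`. -/
def IsSingularWrt {Y : Type*} [TopologicalSpace Y] (X : Set Y) (y : Y) : Prop :=
  IsConnected X ∧
    ∀ C : Set Y, C ⊆ X → IsConnected C → y ∈ closure C → closure C ∩ X = X

end ContinuumTheory

/-!
Let `X` be a dense indecomposable meager composant. The key point is that the quasi-components of
a closed subset `A` of `X` are connected. Quasi-components (or clopen sets shrinking to them) that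
approach a quasi-component `Q` of `A` without being contained in it have as their upper limit a
connected closed set which, because it can meet `A` only in `Q`, is nowhere dense; being a nowhere
dense subcontinuum that meets `X`, it lies in `X`, hence in a connected component of `A`. Were `Q`
the union of two separated closed pieces, a countable clopen partition of the complement of `Q`
could therefore be distributed between the two pieces, and a clopen set would split `Q`.

A connected subset of an indecomposable space is dense or nowhere dense. If `A` omits a non-empty
open subset of `X`, its quasi-components are thus nowhere dense, and clopen subsets of `A` split
every open set contained in `A`: this is strong indecomposability. If `y` is not in `X` and `C` is
a connected subset of `X ∪ {y}` that contains `y` and a point `p` of `X`, the quasi-component of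
`p` in `closure C ∩ X` accumulates at `y`; if it were nowhere dense, `y` would be absorbed by `X`,
so it is dense, and so is `C`. The points outside `X` come from Baire's theorem.
-/

namespace ContinuumTheory

open Filter Set Topology TopologicalSpace

section ClusterPoints

theorem isConnected_setOf_clusterPt {Y : Type*} [TopologicalSpace Y] [CompactSpace Y]
    [NormalSpace Y] {f : Filter Y} {r : Y} (hr : ClusterPt r f)
    (h : ∀ O₁ O₂ : Set Y, IsOpen O₁ → IsOpen O₂ → Disjoint O₁ O₂ → r ∈ O₁ → O₁ ∪ O₂ ∈ f →
      O₁ ∈ f) :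
    IsConnected {y | ClusterPt y f} := by
  refine ⟨⟨r, hr⟩, (isPreconnected_iff_subset_of_fully_disjoint_closed
    isClosed_setOfPred_clusterPt).2 fun u v hu hv huv hdisj ↦ ?_⟩
  suffices key : ∀ u v : Set Y, IsClosed u → IsClosed v → {y | ClusterPt y f} ⊆ u ∪ v →
      Disjoint u v → r ∈ u → {y | ClusterPt y f} ⊆ u from
    (huv hr).imp (key u v hu hv huv hdisj)
      (key v u hv hu (union_comm u v ▸ huv) hdisj.symm)
  intro u v hu hv huv hdisj hru y hy
  obtain ⟨O₁, O₂, hO₁, hO₂, huO, hvO, hO⟩ := normal_separation hu hv hdisj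
  have hunion : O₁ ∪ O₂ ∈ f :=
    isCompact_univ.adherence_nhdset (le_principal_iff.2 univ_mem) (hO₁.union hO₂)
      fun z _ hz ↦ union_subset_union huO hvO (huv hz)
  refine (huv hy).resolve_right fun hyv ↦ ?_
  obtain ⟨z, hz₂, hz₁⟩ := clusterPt_iff_nonempty.1 hy (hO₂.mem_nhds (hvO hyv))
    (h O₁ O₂ hO₁ hO₂ hO (huO hru) hunion)
  exact hO.le_bot ⟨hz₁, hz₂⟩

end ClusterPoints

section QuasiComponents

variable {S : Type*} [TopologicalSpace S]

/-- The filter generated by the clopen sets that contain `s`: the neighbourhoods of `s` in the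
topology generated by the clopen sets. -/
def clopenNhds (s : S) : Filter S :=
  ⨅ G ∈ {G : Set S | IsClopen G ∧ s ∈ G}, 𝓟 G

theorem hasBasis_clopenNhds (s : S) :
    (clopenNhds s).HasBasis (fun G : Set S ↦ IsClopen G ∧ s ∈ G) id :=
  hasBasis_biInf_principal'
    (fun G hG H hH ↦ ⟨G ∩ H, ⟨hG.1.inter hH.1, hG.2, hH.2⟩, inter_subset_left, inter_subset_right⟩)
    ⟨univ, isClopen_univ, mem_univ s⟩

theorem mem_clopenNhds {s : S} {F : Set S} :
    F ∈ clopenNhds s ↔ ∃ G, IsClopen G ∧ s ∈ G ∧ G ⊆ F := by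
  simp only [(hasBasis_clopenNhds s).mem_iff, id, and_assoc]

theorem mem_clopenNhds_or_of_union {s : S} {u v : Set S} (hu : IsOpen u) (hv : IsOpen v)
    (huv : Disjoint u v) (h : u ∪ v ∈ clopenNhds s) : u ∈ clopenNhds s ∨ v ∈ clopenNhds s := by
  obtain ⟨G, hG, hs, hGuv⟩ := mem_clopenNhds.1 h
  refine (hGuv hs).imp (fun hsu ↦ ?_) (fun hsv ↦ ?_)
  · exact mem_clopenNhds.2 ⟨G ∩ u, isClopen_inter_of_disjoint_cover_clopen hG hGuv hu hv huv,
      ⟨hs, hsu⟩, inter_subset_right⟩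
  · exact mem_clopenNhds.2 ⟨G ∩ v, isClopen_inter_of_disjoint_cover_clopen hG
      (union_comm u v ▸ hGuv) hv hu huv.symm, ⟨hs, hsv⟩, inter_subset_right⟩

/-- The quasi-component of `s`: the intersection of the clopen sets that contain `s`. -/
def quasiComponent (s : S) : Set S :=
  (clopenNhds s).ker

theorem mem_quasiComponent {s t : S} :
    t ∈ quasiComponent s ↔ ∀ G : Set S, IsClopen G → s ∈ G → t ∈ G := by
  simp only [quasiComponent, (hasBasis_clopenNhds s).ker, mem_iInter, id, and_imp]

theorem mem_quasiComponent_self (s : S) : s ∈ quasiComponent s :=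
  mem_quasiComponent.2 fun _ _ hs ↦ hs

theorem isClosed_quasiComponent (s : S) : IsClosed (quasiComponent s) := by
  simp only [quasiComponent, (hasBasis_clopenNhds s).ker]
  exact isClosed_biInter fun G hG ↦ hG.1.isClosed

theorem connectedComponent_subset_quasiComponent (s : S) :
    connectedComponent s ⊆ quasiComponent s :=
  fun _ ht ↦ mem_quasiComponent.2 fun _ hG hs ↦ hG.connectedComponent_subset hs ht

theorem clopenNhds_eq_of_mem_quasiComponent {s t : S} (h : t ∈ quasiComponent s) :
    clopenNhds t = clopenNhds s := by
  have hiff : ∀ G : Set S, IsClopen G → (t ∈ G ↔ s ∈ G) := fun G hG ↦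
    ⟨fun ht ↦ by_contra fun hs ↦ mem_quasiComponent.1 h Gᶜ hG.compl hs ht,
      mem_quasiComponent.1 h G hG⟩
  ext F
  simp only [mem_clopenNhds]
  exact exists_congr fun G ↦ and_congr_right fun hG ↦ and_congr_left' (hiff G hG)

theorem quasiComponent_eq {s t : S} (h : t ∈ quasiComponent s) :
    quasiComponent t = quasiComponent s :=
  congrArg ker (clopenNhds_eq_of_mem_quasiComponent h)

theorem compl_quasiComponent_mem_clopenNhds {s t : S} (h : t ∉ quasiComponent s) :
    (quasiComponent s)ᶜ ∈ clopenNhds t := by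
  simp only [mem_quasiComponent, not_forall] at h
  obtain ⟨G, hG, hs, ht⟩ := h
  exact mem_clopenNhds.2 ⟨Gᶜ, hG.compl, ht,
    compl_subset_compl.2 fun z hz ↦ mem_quasiComponent.1 hz G hG hs⟩

/-- The intersection of the clopen sets that contain `N`, that is the closure of `N` in the topology
generated by the clopen sets. A point lies outside it if one of its clopen neighbourhoods is
disjoint from `N`. -/
def clopenClosure (N : Set S) : Set S :=
  {s | ∃ᶠ t in clopenNhds s, t ∈ N}

theorem clopenClosure_mono {M N : Set S} (h : M ⊆ N) : clopenClosure M ⊆ clopenClosure N :=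
  fun _ hs ↦ hs.mono fun _ ht ↦ h ht

theorem mem_of_mem_clopenClosure {N G : Set S} {s : S} (hG : IsClopen G) (hN : N ⊆ G)
    (hs : s ∈ clopenClosure N) : s ∈ G := by
  by_contra h
  exact hs (mem_clopenNhds.2 ⟨Gᶜ, hG.compl, h, fun t ht htN ↦ ht (hN htN)⟩)

end QuasiComponents

section ClopenSeparation

variable {S : Type*} [TopologicalSpace S]

theorem exists_seq_subset_iUnion [SecondCountableTopology S] {𝒰 : Set (Set S)}
    (hne : 𝒰.Nonempty) (h𝒰 : ∀ U ∈ 𝒰, IsOpen U) {T : Set S} (hT : T ⊆ ⋃₀ 𝒰) :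
    ∃ U : ℕ → Set S, (∀ n, U n ∈ 𝒰) ∧ T ⊆ ⋃ n, U n := by
  obtain ⟨U₀, hU₀⟩ := hne
  obtain ⟨𝒟, h𝒟, h𝒟𝒰, hcover⟩ := isOpen_sUnion_countable 𝒰 h𝒰
  obtain ⟨U, hU⟩ := (h𝒟.insert U₀).exists_eq_range (insert_nonempty U₀ 𝒟)
  refine ⟨U, fun n ↦ insert_subset hU₀ h𝒟𝒰 (hU ▸ mem_range_self n), ?_⟩
  rw [← sUnion_range, ← hU, sUnion_insert, hcover]
  exact hT.trans subset_union_right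

theorem exists_seq_disjoint_isClopen_refinement [SecondCountableTopology S] {𝒰 : Set (Set S)}
    (h𝒰 : 𝒰.Nonempty) {T : Set S} (h : ∀ s ∈ T, ∃ U ∈ 𝒰, U ∈ clopenNhds s) :
    ∃ E : ℕ → Set S, (∀ n, IsClopen (E n)) ∧ Pairwise (Function.onFun Disjoint E) ∧
      T ⊆ ⋃ n, E n ∧ ∀ n, ∃ U ∈ 𝒰, E n ⊆ U := by
  obtain ⟨D, hD, hTD⟩ := exists_seq_subset_iUnion (𝒰 := {G | IsClopen G ∧ ∃ U ∈ 𝒰, G ⊆ U})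
    ⟨∅, isClopen_empty, h𝒰.imp fun _ hU ↦ ⟨hU, empty_subset _⟩⟩ (fun G hG ↦ hG.1.isOpen)
    (T := T) fun s hs ↦ by
      obtain ⟨U, hU, hUs⟩ := h s hs
      obtain ⟨G, hG, hsG, hGU⟩ := mem_clopenNhds.1 hUs
      exact ⟨G, ⟨hG, U, hU, hGU⟩, hsG⟩
  refine ⟨disjointed D, fun n ↦ disjointedRec (fun _ _ ht ↦ ht.diff (hD _).1) (hD n).1,
    disjoint_disjointed D, (iUnion_disjointed (f := D)).symm ▸ hTD, fun n ↦ ?_⟩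
  obtain ⟨-, U, hU, hDU⟩ := hD n
  exact ⟨U, hU, (disjointed_subset D n).trans hDU⟩

theorem exists_isClopen_subset_diff_subset [SecondCountableTopology S] {E a b : Set S}
    (hE : IsClopen E) (h : ∀ s ∈ E, a ∈ clopenNhds s ∨ b ∈ clopenNhds s) :
    ∃ F ⊆ E, IsClopen F ∧ F ⊆ a ∧ E \ F ⊆ b := by
  obtain ⟨D, hD, hdisj, hED, hab⟩ :=
    exists_seq_disjoint_isClopen_refinement (insert_nonempty a {b}) (T := E) (by simpa using h)
  simp only [mem_insert_iff, mem_singleton_iff, exists_eq_or_imp, exists_eq_left] at hab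
  let I : Set ℕ := {n | D n ⊆ a}
  have hcompl : E \ (E ∩ ⋃ n ∈ I, D n) = E ∩ ⋃ n ∈ Iᶜ, D n := by
    ext s
    simp only [Set.mem_sdiff, mem_inter_iff, mem_iUnion₂, not_and]
    refine ⟨fun ⟨hs, hI⟩ ↦ ?_, fun ⟨hs, n, hn, hsn⟩ ↦ ⟨hs, fun _ ⟨m, hm, hsm⟩ ↦ ?_⟩⟩
    · obtain ⟨n, hn⟩ := mem_iUnion.1 (hED hs)
      exact ⟨hs, n, fun hnI ↦ hI hs ⟨n, hnI, hn⟩, hn⟩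
    · exact hn (hdisj.eq (not_disjoint_iff.2 ⟨s, hsn, hsm⟩) ▸ hm)
  have hopen : ∀ J : Set ℕ, IsOpen (E ∩ ⋃ n ∈ J, D n) := fun J ↦
    hE.isOpen.inter (isOpen_biUnion fun n _ ↦ (hD n).isOpen)
  refine ⟨E ∩ ⋃ n ∈ I, D n, inter_subset_left, ⟨?_, hopen I⟩, ?_, ?_⟩
  · have : E ∩ ⋃ n ∈ I, D n = E \ (E ∩ ⋃ n ∈ Iᶜ, D n) := by
      rw [← hcompl, sdiff_sdiff_cancel_left inter_subset_left]
    exact this ▸ hE.isClosed.sdiff (hopen Iᶜ)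
  · exact inter_subset_right.trans (iUnion₂_subset fun n hn ↦ hn)
  · rw [hcompl]
    exact inter_subset_right.trans (iUnion₂_subset fun n hn ↦ (hab n).resolve_left hn)

theorem isOpen_union_iUnion_of_inter_subset {A O : Set S} {E F N : ℕ → Set S} (hO : IsOpen O)
    (hAO : A ⊆ O) (hE : ∀ n, IsClosed (E n)) (hAE : ∀ n, Disjoint A (E n))
    (hOE : O ⊆ A ∪ ⋃ n, E n) (hF : ∀ n, IsOpen (F n)) (hN : ∀ k, IsOpen (N k))
    (hAN : A ⊆ ⋃ k, N k) (hEN : ∀ n, ∀ k ≤ n, E n ∩ N k ⊆ F n) :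
    IsOpen (A ∪ ⋃ n, F n) := by
  refine isOpen_iff_mem_nhds.2 ?_
  rintro a (ha | ha)
  · obtain ⟨k, hk⟩ := mem_iUnion.1 (hAN ha)
    have haE : ∀ n, (E n)ᶜ ∈ 𝓝 a := fun n ↦
      (hE n).isOpen_compl.mem_nhds fun hn ↦ (hAE n).le_bot ⟨ha, hn⟩
    filter_upwards [hO.mem_nhds (hAO ha), (hN k).mem_nhds hk,
      (biInter_mem (finite_Iio k)).2 fun n _ ↦ haE n] with z hzO hzN hzE
    refine (hOE hzO).imp_right fun hz ↦ ?_
    obtain ⟨n, hn⟩ := mem_iUnion.1 hz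
    have hkn : k ≤ n := not_lt.1 fun hnk ↦ mem_iInter₂.1 hzE n hnk hn
    exact mem_iUnion.2 ⟨n, hEN n k hkn ⟨hn, hzN⟩⟩
  · exact mem_of_superset ((isOpen_iUnion hF).mem_nhds ha) subset_union_right

theorem isClosed_union_iUnion_of_separated {A B O₁ O₂ : Set S} {E F : ℕ → Set S}
    (hO₂ : IsOpen O₂) (hO : Disjoint O₁ O₂) (hA : A ⊆ O₁) (hB : B ⊆ O₂)
    (hE : ∀ n, IsOpen (E n)) (hdisj : Pairwise (Function.onFun Disjoint E))
    (hcover : ⋃ n, E n = (A ∪ B)ᶜ) (hF : ∀ n, IsClosed (F n)) (hFE : ∀ n, F n ⊆ E n)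
    (hFO : ∀ n, F n ⊆ O₁) :
    IsClosed (A ∪ ⋃ n, F n) := by
  suffices (A ∪ ⋃ n, F n)ᶜ = O₂ ∪ ⋃ n, E n \ F n from
    isOpen_compl_iff.1 (this ▸ hO₂.union (isOpen_iUnion fun n ↦ (hE n).sdiff (hF n)))
  have hE_iff : ∀ z, (∃ n, z ∈ E n) ↔ z ∉ A ∧ z ∉ B := fun z ↦ by
    rw [← mem_iUnion, hcover, mem_compl_iff, mem_union, not_or]
  refine Subset.antisymm (fun z hz ↦ ?_) (union_subset ?_ (iUnion_subset fun n z hz ↦ ?_))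
  · simp only [mem_compl_iff, mem_union, mem_iUnion, not_or, not_exists] at hz
    by_cases hzB : z ∈ B
    · exact Or.inl (hB hzB)
    · obtain ⟨n, hn⟩ := (hE_iff z).2 ⟨hz.1, hzB⟩
      exact Or.inr (mem_iUnion.2 ⟨n, hn, hz.2 n⟩)
  · exact (hO.mono_left (union_subset hA (iUnion_subset hFO))).subset_compl_left
  · rintro (hzA | hzF)
    · exact ((hE_iff z).1 ⟨n, hz.1⟩).1 hzA
    · obtain ⟨m, hm⟩ := mem_iUnion.1 hzF
      obtain rfl := hdisj.eq (not_disjoint_iff.2 ⟨z, hFE m hm, hz.1⟩)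
      exact hz.2 hm

theorem exists_isClopen_superset_disjoint [SecondCountableTopology S] {A B O₁ O₂ : Set S}
    (hO₁ : IsOpen O₁) (hO₂ : IsOpen O₂) (hO : Disjoint O₁ O₂) (hA : A ⊆ O₁) (hB : B ⊆ O₂)
    (hAB : ∀ s ∉ A ∪ B, (A ∪ B)ᶜ ∈ clopenNhds s)
    (hlim : ∀ a ∈ A, ∃ N ∈ 𝓝 a, ∀ s ∉ A ∪ B, s ∈ clopenClosure N → O₁ ∈ clopenNhds s) :
    ∃ G, IsClopen G ∧ A ⊆ G ∧ Disjoint G B := by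
  obtain ⟨N, hN, hAN⟩ := exists_seq_subset_iUnion (T := A)
    (𝒰 := {N | IsOpen N ∧ ∀ s ∉ A ∪ B, s ∈ clopenClosure N → O₁ ∈ clopenNhds s})
    ⟨∅, isOpen_empty, fun s _ hs ↦ (frequently_false _ hs).elim⟩ (fun N hN ↦ hN.1) fun a ha ↦ by
      obtain ⟨N, hN, hNlim⟩ := hlim a ha
      exact ⟨interior N, ⟨isOpen_interior, fun s hs hsN ↦
        hNlim s hs (clopenClosure_mono interior_subset hsN)⟩, mem_interior_iff_mem_nhds.2 hN⟩
  obtain ⟨E, hE, hdisj, hcover, hEAB⟩ :=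
    exists_seq_disjoint_isClopen_refinement (singleton_nonempty (A ∪ B)ᶜ) (T := (A ∪ B)ᶜ)
      fun s hs ↦ ⟨_, rfl, hAB s hs⟩
  simp only [mem_singleton_iff, exists_eq_left] at hEAB
  have hE_eq : ⋃ n, E n = (A ∪ B)ᶜ := (iUnion_subset hEAB).antisymm hcover
  have hsplit : ∀ n, ∀ s ∈ E n, O₁ ∈ clopenNhds s ∨ (⋂ k ∈ Iic n, (N k)ᶜ) ∈ clopenNhds s := by
    refine fun n s hs ↦ or_iff_not_imp_left.2 fun hsO ↦
      (biInter_mem (finite_Iic n)).2 fun k _ ↦ not_frequently.1 fun hk ↦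
        hsO ((hN k).2 s (hEAB n hs) hk)
  choose F hFE hF hFO hEF using fun n ↦ exists_isClopen_subset_diff_subset (hE n) (hsplit n)
  refine ⟨A ∪ ⋃ n, F n, ⟨?_, ?_⟩, subset_union_left, ?_⟩
  · exact isClosed_union_iUnion_of_separated hO₂ hO hA hB (fun n ↦ (hE n).isOpen) hdisj hE_eq
      (fun n ↦ (hF n).isClosed) hFE hFO
  · refine isOpen_union_iUnion_of_inter_subset hO₁ hA (fun n ↦ (hE n).isClosed)
      (fun n ↦ (disjoint_compl_right.mono_left subset_union_left).mono_right (hEAB n)) ?_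
      (fun n ↦ (hF n).isOpen) (fun k ↦ (hN k).1) hAN fun n k hk z hz ↦ ?_
    · rw [hE_eq]
      exact fun z hz ↦ or_iff_not_imp_left.2 fun hzA hzAB ↦
        hO.le_bot ⟨hz, hB (hzAB.resolve_left hzA)⟩
    · exact by_contra fun hzF ↦ mem_iInter₂.1 (hEF n ⟨hz.1, hzF⟩) k hk hz.2
  · exact hO.mono (union_subset hA (iUnion_subset hFO)) hB

end ClopenSeparation

section QuasiLimits

variable {S Y : Type*} [TopologicalSpace S] [TopologicalSpace Y] {e : S → Y} {l : Filter S} {r : S}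

/-- The upper limit along `l` of the traces in `Y` of the clopen neighbourhoods in `S`: a point
belongs to it if each of its neighbourhoods meets `e '' G s` for frequently many `s`, whatever
clopen sets `G s ∋ s` are chosen. For `l = pure s` this is the intersection of the closures of
the sets `e '' G`, where `G ∋ s` is clopen. -/
def quasiLimit (e : S → Y) (l : Filter S) : Set Y :=
  {y | MapClusterPt y (l.bind clopenNhds) e}

theorem mem_quasiLimit {y : Y} :
    y ∈ quasiLimit e l ↔ ∀ O ∈ 𝓝 y, ∃ᶠ z in l.bind clopenNhds, e z ∈ O :=
  mapClusterPt_iff_frequently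

theorem isClosed_quasiLimit : IsClosed (quasiLimit e l) :=
  isClosed_setOfPred_clusterPt

theorem quasiLimit_subset_closure_range : quasiLimit e l ⊆ closure (range e) := fun _ hy ↦
  mem_closure_iff_clusterPt.2 (ClusterPt.mono hy (le_principal_iff.2 range_mem_map))

theorem pure_le_lift'_clopenClosure (s : S) : pure s ≤ (𝓝 s).lift' clopenClosure :=
  le_lift'.2 fun _ hN ↦ mem_pure.2 fun hs ↦ by
    obtain ⟨G, -, hsG, hGN⟩ := mem_clopenNhds.1 hs
    exact hGN hsG (mem_of_mem_nhds hN)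

theorem eventually_frequently_clopenNhds (hl : l ≤ (𝓝 r).lift' clopenClosure) {N : Set S}
    (hN : N ∈ 𝓝 r) : ∀ᶠ s in l, ∃ᶠ t in clopenNhds s, t ∈ N :=
  hl (mem_lift' hN)

theorem bind_clopenNhds_le (hl : l ≤ (𝓝 r).lift' clopenClosure) :
    l.bind clopenNhds ≤ clopenNhds r := by
  intro F hF
  obtain ⟨G, hG, hr, hGF⟩ := mem_clopenNhds.1 hF
  refine mem_bind'.2 ?_
  filter_upwards [eventually_frequently_clopenNhds hl (hG.isOpen.mem_nhds hr)] with s hs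
  exact mem_clopenNhds.2 ⟨G, hG, mem_of_mem_clopenClosure hG Subset.rfl hs, hGF⟩

theorem apply_mem_quasiLimit [l.NeBot] (he : Continuous e)
    (hl : l ≤ (𝓝 r).lift' clopenClosure) : e r ∈ quasiLimit e l :=
  mem_quasiLimit.2 fun _ hO ↦
    frequently_bind.2 (eventually_frequently_clopenNhds hl (he.continuousAt hO)).frequently

theorem isConnected_quasiLimit [CompactSpace Y] [NormalSpace Y] [l.NeBot] (he : Continuous e)
    (hl : l ≤ (𝓝 r).lift' clopenClosure) : IsConnected (quasiLimit e l) := by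
  refine isConnected_setOf_clusterPt (apply_mem_quasiLimit he hl)
    fun O₁ O₂ hO₁ hO₂ hO hr hmem ↦ ?_
  rw [mem_map, mem_bind'] at hmem ⊢
  filter_upwards [eventually_frequently_clopenNhds hl ((hO₁.preimage he).mem_nhds hr),
    hmem] with s hs hsO
  refine (mem_clopenNhds_or_of_union (hO₁.preimage he) (hO₂.preimage he) (hO.preimage e)
    hsO).resolve_right fun hs₂ ↦ hs ?_
  filter_upwards [hs₂] with t ht₂ ht₁ using hO.le_bot ⟨ht₁, ht₂⟩

theorem mem_quasiComponent_of_apply_mem_quasiLimit (he : IsInducing e)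
    (hl : l ≤ (𝓝 r).lift' clopenClosure) {z : S} (hz : e z ∈ quasiLimit e l) :
    z ∈ quasiComponent r := by
  refine mem_quasiComponent.2 fun G hG hr ↦ by_contra fun hzG ↦ ?_
  obtain ⟨O, hO, hOG⟩ := mem_comap.1 (he.nhds_eq_comap z ▸ hG.compl.isOpen.mem_nhds hzG)
  obtain ⟨t, htO, htG⟩ := ((mem_quasiLimit.1 hz O hO).and_eventually
    (bind_clopenNhds_le hl (mem_clopenNhds.2 ⟨G, hG, hr, Subset.rfl⟩))).exists
  exact hOG htO htG

theorem isNowhereDense_quasiLimit (he : IsInducing e) (hl : l ≤ (𝓝 r).lift' clopenClosure)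
    (hr : ∀ᶠ s in l, s ∉ quasiComponent r) : IsNowhereDense (quasiLimit e l) := by
  rw [IsNowhereDense, isClosed_quasiLimit.closure_eq, eq_empty_iff_forall_notMem]
  intro y hy
  have hfreq : ∃ᶠ z in l.bind clopenNhds, z ∈ quasiComponent r :=
    (mem_quasiLimit.1 (interior_subset hy) _ (isOpen_interior.mem_nhds hy)).mono
      fun z hz ↦ mem_quasiComponent_of_apply_mem_quasiLimit he hl (interior_subset hz)
  exact hfreq (hr.mono fun s hs ↦ compl_quasiComponent_mem_clopenNhds hs)

/-- `X` contains every nowhere dense subcontinuum of its closure that it meets. Meager composants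
have this property, and so do their relatively closed subsets, where it traps upper limits of
quasi-components. -/
def AbsorbsNowhereDense (X : Set Y) : Prop :=
  ∀ L : Set Y, IsSubcontinuum L → IsNowhereDense L → L ⊆ closure X → (L ∩ X).Nonempty → L ⊆ X

theorem quasiLimit_subset_range [CompactSpace Y] [NormalSpace Y] [l.NeBot] (he : Continuous e)
    (habs : AbsorbsNowhereDense (range e)) (hl : l ≤ (𝓝 r).lift' clopenClosure)
    (hn : IsNowhereDense (quasiLimit e l)) : quasiLimit e l ⊆ range e :=
  habs _ ⟨isClosed_quasiLimit.isCompact, isConnected_quasiLimit he hl⟩ hn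
    quasiLimit_subset_closure_range ⟨e r, apply_mem_quasiLimit he hl, mem_range_self r⟩

theorem exists_nhds_forall_mem_clopenNhds [CompactSpace Y] [NormalSpace Y] (he : IsInducing e)
    (habs : AbsorbsNowhereDense (range e)) {O : Set S} (hO : IsOpen O)
    (hr : connectedComponent r ⊆ O) :
    ∃ N ∈ 𝓝 r, ∀ s ∈ clopenClosure N, s ∉ quasiComponent r → O ∈ clopenNhds s := by
  suffices {s | O ∈ clopenNhds s} ∈ (𝓝 r).lift' clopenClosure ⊓ 𝓟 (quasiComponent r)ᶜ by
    obtain ⟨N, hN, hNO⟩ :=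
      (mem_lift'_sets fun _ _ ↦ clopenClosure_mono).1 (mem_inf_principal.1 this)
    exact ⟨N, hN, hNO⟩
  obtain hbot | hne := ((𝓝 r).lift' clopenClosure ⊓ 𝓟 (quasiComponent r)ᶜ).eq_or_neBot
  · exact hbot ▸ mem_bot
  set l := (𝓝 r).lift' clopenClosure ⊓ 𝓟 (quasiComponent r)ᶜ
  have hl : l ≤ (𝓝 r).lift' clopenClosure := inf_le_left
  have hrange : quasiLimit e l ⊆ range e := quasiLimit_subset_range he.continuous habs hl
    (isNowhereDense_quasiLimit he hl (mem_inf_of_right (mem_principal_self _)))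
  have hcomp : e ⁻¹' quasiLimit e l ⊆ connectedComponent r := by
    refine IsPreconnected.subset_connectedComponent ?_ (apply_mem_quasiLimit he.continuous hl)
    rw [← he.isPreconnected_image, image_preimage_eq_of_subset hrange]
    exact (isConnected_quasiLimit he.continuous hl).isPreconnected
  obtain ⟨O', hO', rfl⟩ := he.isOpen_iff.1 hO
  refine mem_bind'.1 (mem_map.1 (isCompact_univ.adherence_nhdset (le_principal_iff.2 univ_mem) hO'
    fun y _ hy ↦ ?_))
  obtain ⟨z, rfl⟩ := hrange hy
  exact hr (hcomp hy)

theorem isPreconnected_quasiComponent [CompactSpace Y] [T2Space Y] [SecondCountableTopology Y]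
    (he : IsInducing e) (habs : AbsorbsNowhereDense (range e)) (s : S) :
    IsPreconnected (quasiComponent s) := by
  have := he.secondCountableTopology
  have := he.regularSpace
  refine (isPreconnected_iff_subset_of_fully_disjoint_closed
    (isClosed_quasiComponent s)).2 fun u v hu hv huv hdisj ↦ ?_
  obtain ⟨O₁, O₂, hO₁, hO₂, hu₁, hv₂, hO⟩ := normal_separation hu hv hdisj
  have hunion : quasiComponent s ∩ u ∪ quasiComponent s ∩ v = quasiComponent s := by
    rw [← inter_union_distrib_left, inter_eq_left.2 huv]
  have hcomp : ∀ a ∈ quasiComponent s ∩ u, connectedComponent a ⊆ O₁ := fun a ha ↦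
    isPreconnected_connectedComponent.subset_left_of_subset_union hO₁ hO₂ hO
      (((connectedComponent_subset_quasiComponent a).trans
        (quasiComponent_eq ha.1 ▸ huv)).trans (union_subset_union hu₁ hv₂))
      ⟨a, mem_connectedComponent, hu₁ ha.2⟩
  obtain ⟨G, hG, huG, hvG⟩ := exists_isClopen_superset_disjoint hO₁ hO₂ hO
    (inter_subset_right.trans hu₁) (inter_subset_right.trans hv₂)
    (by rw [hunion]; exact fun t ht ↦ compl_quasiComponent_mem_clopenNhds ht)
    (fun a ha ↦ by
      obtain ⟨N, hN, hNO⟩ := exists_nhds_forall_mem_clopenNhds he habs hO₁ (hcomp a ha)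
      rw [hunion, ← quasiComponent_eq ha.1]
      exact ⟨N, hN, fun t ht htN ↦ hNO t htN ht⟩)
  by_cases hsG : s ∈ G
  · refine Or.inl fun t ht ↦ (huv ht).resolve_right fun htv ↦ hvG.le_bot ⟨?_, ht, htv⟩
    exact mem_quasiComponent.1 ht G hG hsG
  · refine Or.inr fun t ht ↦ (huv ht).resolve_left fun htu ↦ ?_
    exact mem_quasiComponent.1 ht Gᶜ hG.compl hsG (huG ⟨ht, htu⟩)

end QuasiLimits

section Indecomposability

variable {Z : Type*} [TopologicalSpace Z]

theorem exists_isOpen_eq_union_of_not_isPreconnected {W : Set Z} (hW : IsOpen W)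
    (h : ¬ IsPreconnected W) : ∃ A B : Set Z, IsOpen A ∧ IsOpen B ∧ A.Nonempty ∧ B.Nonempty ∧
      Disjoint A B ∧ W = A ∪ B := by
  rw [isPreconnected_iff_subset_of_disjoint] at h
  push Not at h
  obtain ⟨u, v, hu, hv, huv, hdisj, hWu, hWv⟩ := h
  obtain ⟨a, haW, hau⟩ := not_subset.1 hWu
  obtain ⟨b, hbW, hbv⟩ := not_subset.1 hWv
  refine ⟨W ∩ u, W ∩ v, hW.inter hu, hW.inter hv, ⟨b, hbW, (huv hbW).resolve_right hbv⟩,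
    ⟨a, haW, (huv haW).resolve_left hau⟩, ?_, ?_⟩
  · rw [disjoint_iff_inter_eq_empty, ← inter_inter_distrib_left, hdisj]
  · rw [← inter_union_distrib_left, inter_eq_left.2 huv]

theorem isPreconnected_compl_of_compl_eq_union [PreconnectedSpace Z] {C A B : Set Z}
    (hC : IsConnected C) (hA : IsOpen A) (hB : IsOpen B) (hAB : Disjoint A B) (h : Cᶜ = A ∪ B) :
    IsPreconnected Bᶜ := by
  have hCB : C ⊆ Bᶜ := subset_compl_comm.1 (h ▸ subset_union_right)
  refine (isPreconnected_iff_subset_of_fully_disjoint_closed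
    hB.isClosed_compl).2 fun u v hu hv huv hdisj ↦ ?_
  suffices key : ∀ u v : Set Z, IsClosed u → IsClosed v → Bᶜ ⊆ u ∪ v → Disjoint u v → C ⊆ u →
      Bᶜ ⊆ u from
    ((isPreconnected_iff_subset_of_disjoint_closed.1 hC.isPreconnected) u v hu hv (hCB.trans huv)
      (by rw [hdisj.inter_eq, inter_empty])).imp (key u v hu hv huv hdisj)
      (key v u hv hu (union_comm u v ▸ huv) hdisj.symm)
  intro u v hu hv huv hdisj hCu
  have heq : Bᶜ ∩ v = A ∩ uᶜ := by
    refine Subset.antisymm (fun z ⟨hzB, hzv⟩ ↦ ?_) fun z ⟨hzA, hzu⟩ ↦ ?_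
    · have hzu : z ∉ u := fun hzu ↦ hdisj.le_bot ⟨hzu, hzv⟩
      have hzAB : z ∈ A ∪ B := h ▸ fun hzC ↦ hzu (hCu hzC)
      exact ⟨hzAB.resolve_right hzB, hzu⟩
    · have hzB : z ∈ Bᶜ := fun hzB ↦ hAB.le_bot ⟨hzA, hzB⟩
      exact ⟨hzB, (huv hzB).resolve_left hzu⟩
  have hclopen : IsClopen (Bᶜ ∩ v) :=
    ⟨hB.isClosed_compl.inter hv, heq ▸ hA.inter hu.isOpen_compl⟩
  obtain hempty | huniv := isClopen_iff.1 hclopen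
  · exact fun z hz ↦ (huv hz).resolve_right fun hzv ↦ (hempty ▸ ⟨hz, hzv⟩ : z ∈ (∅ : Set Z))
  · obtain ⟨c, hc⟩ := hC.nonempty
    exact (hdisj.le_bot ⟨hCu hc, (huniv ▸ mem_univ c : c ∈ Bᶜ ∩ v).2⟩).elim

theorem isIndecomposable_iff_dense : IsIndecomposable Z ↔ ConnectedSpace Z ∧
    ∀ H K : Set Z, IsConnected H → IsConnected K → H ∪ K = univ → Dense H ∨ Dense K := by
  refine and_congr_right fun _ ↦ ⟨fun h H K hH hK hHK ↦ ?_, fun h ↦ ?_⟩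
  · by_contra! hdense
    simp only [dense_iff_closure_eq] at hdense
    exact h ⟨closure H, closure K, isClosed_closure, hH.closure, hdense.1, isClosed_closure,
      hK.closure, hdense.2, eq_univ_of_univ_subset
        (hHK ▸ union_subset_union subset_closure subset_closure)⟩
  · rintro ⟨H, K, hHc, hH, hHne, hKc, hK, hKne, hHK⟩
    refine (h H K hH hK hHK).elim (fun hd ↦ hHne ?_) (fun hd ↦ hKne ?_)
    · exact hHc.closure_eq ▸ hd.closure_eq
    · exact hKc.closure_eq ▸ hd.closure_eq

theorem isIrreducibleConnected_iff_dense : IsIrreducibleConnected Z ↔ ConnectedSpace Z ∧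
    ∃ p q : Z, ∀ C : Set Z, IsConnected C → p ∈ C → q ∈ C → Dense C := by
  refine and_congr_right fun _ ↦ exists₂_congr fun p q ↦
    ⟨fun h C hC hp hq ↦ ?_, fun h C hCc hC hp hq ↦ ?_⟩
  · exact dense_iff_closure_eq.2
      (h _ isClosed_closure hC.closure (subset_closure hp) (subset_closure hq))
  · exact hCc.closure_eq ▸ (h C hC hp hq).closure_eq

theorem IsIndecomposable.dense_of_not_isNowhereDense (h : IsIndecomposable Z) {C : Set Z}
    (hC : IsConnected C) (hCn : ¬ IsNowhereDense C) : Dense C := by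
  obtain ⟨_, hind⟩ := isIndecomposable_iff_dense.1 h
  by_contra hCd
  have hne : (closure C)ᶜ.Nonempty := nonempty_compl.2 fun hc ↦ hCd (dense_iff_closure_eq.2 hc)
  have hnot : ¬ IsPreconnected (closure C)ᶜ := fun hpre ↦
    (hind _ _ hC.closure ⟨hne, hpre⟩ (union_compl_self _)).elim (fun hd ↦ hCd hd.of_closure)
      fun hd ↦ hCn (interior_eq_empty_iff_dense_compl.2 hd)
  obtain ⟨A, B, hA, hB, hAne, hBne, hAB, hcompl⟩ :=
    exists_isOpen_eq_union_of_not_isPreconnected isClosed_closure.isOpen_compl hnot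
  have hCA : closure C ⊆ Aᶜ := subset_compl_comm.1 (hcompl ▸ subset_union_left)
  have hCB : closure C ⊆ Bᶜ := subset_compl_comm.1 (hcompl ▸ subset_union_right)
  have hAconn : IsConnected Aᶜ := ⟨hC.closure.nonempty.mono hCA,
    isPreconnected_compl_of_compl_eq_union hC.closure hB hA hAB.symm (union_comm A B ▸ hcompl)⟩
  have hBconn : IsConnected Bᶜ := ⟨hC.closure.nonempty.mono hCB,
    isPreconnected_compl_of_compl_eq_union hC.closure hA hB hAB hcompl⟩
  have not_dense_compl : ∀ {W : Set Z}, IsOpen W → W.Nonempty → ¬ Dense Wᶜ :=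
    fun hW hWne hd ↦ (hd.inter_open_nonempty _ hW hWne).ne_empty (inter_compl_self _)
  have hunion : Aᶜ ∪ Bᶜ = univ := by rw [← compl_inter, hAB.inter_eq, compl_empty]
  exact (hind _ _ hAconn hBconn hunion).elim (not_dense_compl hA hAne) (not_dense_compl hB hBne)

theorem IsStronglyIndecomposable.isIndecomposable (h : IsStronglyIndecomposable Z) :
    IsIndecomposable Z := by
  refine ⟨h.1, ?_⟩
  rintro ⟨H, K, hH, hHconn, hHne, hK, -, hKne, hHK⟩
  obtain ⟨A, B, hA, hB, hAB, hHAB, hAH, hBH⟩ := h.2 Hᶜ Kᶜ hH.isOpen_compl hK.isOpen_compl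
    (nonempty_compl.2 hHne) (nonempty_compl.2 hKne)
    (disjoint_compl_left_iff_subset.2 (compl_subset_iff_union.2 (union_comm H K ▸ hHK)))
  rw [compl_compl] at hHAB
  obtain ⟨a, haA, -⟩ := hAH
  obtain ⟨b, hbB, -⟩ := hBH
  obtain hHA | hHB := (isPreconnected_iff_subset_of_fully_disjoint_closed hH).1
    hHconn.isPreconnected A B hA hB hHAB.subset hAB
  · exact hAB.le_bot ⟨hHA (hHAB ▸ Or.inr hbB), hbB⟩
  · exact hAB.le_bot ⟨haA, hHB (hHAB ▸ Or.inl haA)⟩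

theorem IsIndecomposable.isStronglyIndecomposable (h : IsIndecomposable Z)
    (hq : ∀ C : Set Z, IsClosed C → ∀ s : C, IsPreconnected (quasiComponent s)) :
    IsStronglyIndecomposable Z := by
  refine ⟨h.1, fun U V hU hV hUne ⟨v, hv⟩ hUV ↦ ?_⟩
  have hUc : IsClosed Uᶜ := hU.isClosed_compl
  have hVU : V ⊆ Uᶜ := hUV.subset_compl_left
  let s : ↥Uᶜ := ⟨v, hVU hv⟩
  have hclosed : ∀ F : Set ↥Uᶜ, IsClosed F → IsClosed (Subtype.val '' F) :=
    hUc.isClosedEmbedding_subtypeVal.isClosedMap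
  obtain ⟨w, hw, hws⟩ : ∃ w, ∃ hw : w ∈ V, ⟨w, hVU hw⟩ ∉ quasiComponent s := by
    by_contra! hV_sub
    have hVint : V ⊆ Subtype.val '' quasiComponent s := fun w hw ↦ ⟨_, hV_sub w hw, rfl⟩
    have hconn : IsConnected (Subtype.val '' quasiComponent s) :=
      ⟨⟨v, hVint hv⟩, (hq Uᶜ hUc s).image _ continuous_subtype_val.continuousOn⟩
    have hdense := h.dense_of_not_isNowhereDense hconn fun hn ↦
      (hn ▸ interior_maximal (hVint.trans subset_closure) hV hv : v ∈ (∅ : Set Z))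
    obtain ⟨z, hzU, t, -, rfl⟩ := hdense.inter_open_nonempty U hU hUne
    exact t.2 hzU
  simp only [mem_quasiComponent, not_forall] at hws
  obtain ⟨G, hG, hsG, hwG⟩ := hws
  refine ⟨Subtype.val '' G, Subtype.val '' Gᶜ, hclosed G hG.isClosed, hclosed Gᶜ hG.compl.isClosed,
    (disjoint_image_iff Subtype.val_injective).2 disjoint_compl_right, ?_,
    ⟨v, ⟨s, hsG, rfl⟩, hv⟩, ⟨w, ⟨_, hwG, rfl⟩, hw⟩⟩
  rw [← image_union, union_compl_self, image_univ, Subtype.range_coe]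

end Indecomposability

section DenseSubsets

variable {Y : Type*} [TopologicalSpace Y] {X : Set Y}

theorem isConnected_image_val_iff {C : Set X} :
    IsConnected (Subtype.val '' C) ↔ IsConnected C :=
  and_congr image_nonempty IsInducing.subtypeVal.isPreconnected_image

theorem subset_closure_iff_dense (hX : Dense X) {C : Set Y} : X ⊆ closure C ↔ Dense C :=
  ⟨fun h ↦ (hX.mono h).of_closure, fun h ↦ h.closure_eq ▸ subset_univ X⟩

theorem dense_image_val_iff (hX : Dense X) {C : Set X} : Dense (Subtype.val '' C) ↔ Dense C := by
  rw [← subset_closure_iff_dense hX, Subtype.dense_iff]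

theorem isIndecomposable_subtype_iff (hX : Dense X) : IsIndecomposable X ↔ IsConnected X ∧
    ∀ H K : Set Y, IsConnected H → IsConnected K → H ∪ K = X → Dense H ∨ Dense K := by
  rw [isIndecomposable_iff_dense, isConnected_iff_connectedSpace]
  refine and_congr_right fun _ ↦ ⟨fun h H K hH hK hHK ↦ ?_, fun h H K hH hK hHK ↦ ?_⟩
  · have hHX : Subtype.val '' (Subtype.val ⁻¹' H : Set X) = H :=
      Subtype.image_preimage_val X H ▸ inter_eq_right.2 (hHK ▸ subset_union_left)
    have hKX : Subtype.val '' (Subtype.val ⁻¹' K : Set X) = K :=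
      Subtype.image_preimage_val X K ▸ inter_eq_right.2 (hHK ▸ subset_union_right)
    rw [← hHX, ← hKX, dense_image_val_iff hX, dense_image_val_iff hX]
    rw [← hHX, isConnected_image_val_iff] at hH
    rw [← hKX, isConnected_image_val_iff] at hK
    exact h _ _ hH hK (by rw [← preimage_union, hHK, Subtype.coe_preimage_self])
  · rw [← dense_image_val_iff hX, ← dense_image_val_iff hX]
    exact h _ _ (isConnected_image_val_iff.2 hH) (isConnected_image_val_iff.2 hK)
      (by rw [← image_union, hHK, image_univ, Subtype.range_val])

theorem isIrreducibleConnected_subtype_iff (hX : Dense X) : IsIrreducibleConnected X ↔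
    IsConnected X ∧ ∃ p ∈ X, ∃ q ∈ X, ∀ C ⊆ X, IsConnected C → p ∈ C → q ∈ C → Dense C := by
  rw [isIrreducibleConnected_iff_dense, isConnected_iff_connectedSpace]
  simp only [Subtype.exists, ← exists_prop, ← dense_image_val_iff hX,
    ← isConnected_image_val_iff (X := X)]
  refine exists_congr fun _ ↦ exists₂_congr fun p hp ↦ exists₂_congr fun q hq ↦ ?_
  rw [← Subtype.forall_set_subtype (fun C : Set Y ↦ IsConnected C → p ∈ C → q ∈ C → Dense C)]
  simp [hp, hq]

theorem isSingularWrt_iff (hX : Dense X) {y : Y} : IsSingularWrt X y ↔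
    IsConnected X ∧ ∀ C ⊆ X, IsConnected C → y ∈ closure C → Dense C := by
  simp only [IsSingularWrt, inter_eq_right, subset_closure_iff_dense hX]

theorem IsSingularWrt.isIndecomposable (hX : Dense X) {y : Y} (h : IsSingularWrt X y) :
    IsIndecomposable X := by
  obtain ⟨hXc, hsing⟩ := (isSingularWrt_iff hX).1 h
  refine (isIndecomposable_subtype_iff hX).2 ⟨hXc, fun H K hH hK hHK ↦ ?_⟩
  have hy : y ∈ closure H ∪ closure K := by
    rw [← closure_union, hHK]
    exact hX y
  exact hy.imp (hsing H (hHK ▸ subset_union_left) hH) (hsing K (hHK ▸ subset_union_right) hK)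

theorem IsIndecomposable.dense_of_subset (h : IsIndecomposable X) (hX : Dense X) {C : Set Y}
    (hCX : C ⊆ X) (hC : IsConnected C) (hCn : ¬ IsNowhereDense C) : Dense C := by
  obtain ⟨C, rfl⟩ : ∃ C' : Set X, Subtype.val '' C' = C :=
    ⟨Subtype.val ⁻¹' C, by rw [Subtype.image_preimage_val, inter_eq_right.2 hCX]⟩
  rw [dense_image_val_iff hX]
  refine h.dense_of_not_isNowhereDense (isConnected_image_val_iff.1 hC) fun hn ↦ hCn ?_
  have hsub : Subtype.val ⁻¹' interior (closure (Subtype.val '' C)) ⊆ interior (closure C) :=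
    interior_maximal (by
      rw [IsInducing.subtypeVal.closure_eq_preimage_closure_image]
      exact preimage_mono interior_subset) (isOpen_interior.preimage continuous_subtype_val)
  refine not_nonempty_iff_eq_empty.1 fun hne ↦ ?_
  obtain ⟨z, hz, hzX⟩ := hX.inter_open_nonempty _ isOpen_interior hne
  exact (hn ▸ hsub (a := ⟨z, hzX⟩) hz : (⟨z, hzX⟩ : X) ∈ (∅ : Set X))

end DenseSubsets

section AbsorbingSubsets

variable {Y : Type*} [TopologicalSpace Y] {X : Set Y} {y : Y}

theorem AbsorbsNowhereDense.of_closure_inter_subset (habs : AbsorbsNowhereDense X) {A : Set Y}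
    (hAX : A ⊆ X) (hA : closure A ∩ X ⊆ A) : AbsorbsNowhereDense A :=
  fun L hL hLn hLA hLne _ hz ↦ hA ⟨hLA hz, habs L hL hLn (hLA.trans (closure_mono hAX))
    (hLne.mono (inter_subset_inter_right L hAX)) hz⟩

theorem isPreconnected_quasiComponent_of_isClosed [CompactSpace Y] [T2Space Y]
    [SecondCountableTopology Y] (habs : AbsorbsNowhereDense X) {C : Set X} (hC : IsClosed C)
    (s : C) : IsPreconnected (quasiComponent s) := by
  refine isPreconnected_quasiComponent (e := Subtype.val ∘ Subtype.val)
    (IsInducing.subtypeVal.comp IsInducing.subtypeVal) ?_ s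
  rw [range_comp, Subtype.range_val]
  refine habs.of_closure_inter_subset (Subtype.coe_image_subset X C) fun z ⟨hzC, hzX⟩ ↦ ?_
  exact ⟨⟨z, hzX⟩, hC.closure_eq ▸ closure_subtype.2 hzC, rfl⟩

theorem mem_quasiLimit_of_isPreconnected_insert {S : Type*} [TopologicalSpace S] [T1Space Y]
    {e : S → Y} (he : IsInducing e) (hy : y ∉ range e)
    (hconn : IsPreconnected (insert y (range e))) (s : S) : y ∈ quasiLimit e (pure s) := by
  rw [mem_quasiLimit, pure_bind]
  intro O hO hsO
  obtain ⟨G, hG, hsG, hGO⟩ := mem_clopenNhds.1 hsO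
  have hyG : y ∉ closure (e '' G) := fun h ↦ by
    obtain ⟨_, hzO, z, hzG, rfl⟩ := mem_closure_iff_nhds.1 h O hO
    exact hGO hzG hzO
  have hpre : ∀ F : Set S, IsClosed F → e ⁻¹' closure (e '' F) = F := fun F hF ↦ by
    rw [← he.closure_eq_preimage_closure_image, hF.closure_eq]
  have hcover : insert y (range e) ⊆ closure (e '' G) ∪ ({y} ∪ closure (e '' Gᶜ)) := by
    rintro _ (rfl | ⟨z, rfl⟩)
    · exact Or.inr (Or.inl rfl)
    · by_cases hz : z ∈ G
      · exact Or.inl (subset_closure (mem_image_of_mem e hz))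
      · exact Or.inr (Or.inr (subset_closure (mem_image_of_mem e hz)))
  obtain ⟨z, hz, hzG, hz'⟩ := isPreconnected_closed_iff.1 hconn _ _ isClosed_closure
    (isClosed_singleton.union isClosed_closure) hcover
    ⟨e s, Or.inr (mem_range_self s), subset_closure (mem_image_of_mem e hsG)⟩
    ⟨y, mem_insert y _, Or.inl rfl⟩
  obtain rfl | ⟨w, rfl⟩ := hz
  · exact hyG hzG
  · have hw : w ∈ Gᶜ := hpre Gᶜ hG.compl.isClosed ▸ hz'.resolve_left fun hwy ↦ hy ⟨w, hwy⟩
    exact hw (hpre G hG.isClosed ▸ hzG)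

theorem not_isNowhereDense_image_quasiComponent [CompactSpace Y] [T2Space Y] (hX : Dense X)
    {A : Set Y} (habs : AbsorbsNowhereDense A) (hA : closure A ∩ X ⊆ A) (hy : y ∉ A)
    (hconn : IsPreconnected (insert y A)) (s : A) :
    ¬ IsNowhereDense (Subtype.val '' quasiComponent s) := by
  have hrange : range (Subtype.val : A → Y) = A := Subtype.range_val
  have hs := pure_le_lift'_clopenClosure s
  have hyL : y ∈ quasiLimit (Subtype.val : A → Y) (pure s) :=
    mem_quasiLimit_of_isPreconnected_insert .subtypeVal (by rwa [hrange]) (by rwa [hrange]) s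
  have hL : quasiLimit (Subtype.val : A → Y) (pure s) ∩ X ⊆ Subtype.val '' quasiComponent s :=
    fun z ⟨hzL, hzX⟩ ↦ by
      have hzA : z ∈ A := hA ⟨hrange ▸ quasiLimit_subset_closure_range hzL, hzX⟩
      exact ⟨⟨z, hzA⟩, mem_quasiComponent_of_apply_mem_quasiLimit .subtypeVal hs hzL, rfl⟩
  refine fun hn ↦ hy (hrange.subset (quasiLimit_subset_range continuous_subtype_val
    (by rwa [hrange]) hs ?_ hyL))
  rw [IsNowhereDense, isClosed_quasiLimit.closure_eq, ← subset_empty_iff, ← hn]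
  exact interior_maximal ((hX.open_subset_closure_inter isOpen_interior).trans
    (closure_mono ((inter_subset_inter_left X interior_subset).trans hL))) isOpen_interior

theorem IsIndecomposable.isSingularWrt [CompactSpace Y] (h : IsIndecomposable X)
    (hX : Dense X) (habs : AbsorbsNowhereDense X) (hy : y ∉ X) : IsSingularWrt X y := by
  refine (isSingularWrt_iff hX).2 ⟨isConnected_iff_connectedSpace.2 h.1,
    fun C hCX hC hyC ↦ h.dense_of_subset hX hCX hC fun hCn ↦ hy ?_⟩
  exact habs (closure C) ⟨isClosed_closure.isCompact, hC.closure⟩ hCn.closure (closure_mono hCX)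
    (hC.nonempty.mono (subset_inter subset_closure hCX)) hyC

theorem IsIndecomposable.dense_of_subset_union_singleton [CompactSpace Y] [T2Space Y]
    [SecondCountableTopology Y] (h : IsIndecomposable X) (hX : Dense X)
    (habs : AbsorbsNowhereDense X) (hy : y ∉ X) {C : Set Y} (hCX : C ⊆ X ∪ {y})
    (hC : IsConnected C) (hyC : y ∈ C) {p : Y} (hp : p ∈ X) (hpC : p ∈ C) : Dense C := by
  have hA : closure (closure C ∩ X) ∩ X ⊆ closure C ∩ X :=
    inter_subset_inter_left X (closure_minimal inter_subset_left isClosed_closure)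
  have habsA : AbsorbsNowhereDense (closure C ∩ X) :=
    habs.of_closure_inter_subset inter_subset_right hA
  let s : ↥(closure C ∩ X) := ⟨p, subset_closure hpC, hp⟩
  have hconn : IsPreconnected (insert y (closure C ∩ X)) :=
    hC.isPreconnected.subset_closure
      (fun z hz ↦ (hCX hz).symm.imp_right fun hzX ↦ ⟨subset_closure hz, hzX⟩)
      (insert_subset (subset_closure hyC) inter_subset_left)
  have hQ : IsConnected (Subtype.val '' quasiComponent s) :=
    ⟨⟨p, s, mem_quasiComponent_self s, rfl⟩, (isPreconnected_quasiComponent .subtypeVal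
      (Subtype.range_val.symm ▸ habsA) s).image _ continuous_subtype_val.continuousOn⟩
  have hQA := Subtype.coe_image_subset (closure C ∩ X) (quasiComponent s)
  exact ((h.dense_of_subset hX (hQA.trans inter_subset_right) hQ
    (not_isNowhereDense_image_quasiComponent hX habsA hA (fun hyA ↦ hy hyA.2) hconn s)).mono
      (hQA.trans inter_subset_left)).of_closure

theorem isConnected_union_singleton (hX : Dense X) (hXc : IsConnected X) (y : Y) :
    IsConnected (X ∪ {y}) :=
  hXc.subset_closure subset_union_left (hX.closure_eq ▸ subset_univ _)

theorem IsIndecomposable.isIrreducibleConnected_union_singleton [CompactSpace Y] [T2Space Y]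
    [SecondCountableTopology Y] (h : IsIndecomposable X) (hX : Dense X)
    (habs : AbsorbsNowhereDense X) (hy : y ∉ X) : IsIrreducibleConnected ↥(X ∪ {y}) := by
  have hXc : IsConnected X := isConnected_iff_connectedSpace.2 h.1
  obtain ⟨p, hp⟩ := hXc.nonempty
  exact (isIrreducibleConnected_subtype_iff (hX.mono subset_union_left)).2
    ⟨isConnected_union_singleton hX hXc y, p, Or.inl hp, y, Or.inr rfl,
      fun C hCX hC hpC hyC ↦ h.dense_of_subset_union_singleton hX habs hy hCX hC hyC hp hpC⟩

theorem IsIndecomposable.union_singleton [CompactSpace Y] [T2Space Y]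
    [SecondCountableTopology Y] (h : IsIndecomposable X) (hX : Dense X)
    (habs : AbsorbsNowhereDense X) (y : Y) : IsIndecomposable ↥(X ∪ {y}) := by
  by_cases hy : y ∈ X
  · rwa [union_eq_left.2 (singleton_subset_iff.2 hy)]
  have hdense : ∀ H K : Set Y, IsConnected H → H ∪ K = X ∪ {y} → y ∈ H → Dense H ∨ Dense K := by
    intro H K hH hHK hyH
    by_cases hXH : ∃ p ∈ X, p ∈ H
    · obtain ⟨p, hp, hpH⟩ := hXH
      exact Or.inl (h.dense_of_subset_union_singleton hX habs hy (hHK ▸ subset_union_left) hH hyH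
        hp hpH)
    · have hXK : X ⊆ K := fun p hp ↦
        (hHK.superset (Or.inl hp)).resolve_left fun hpH ↦ hXH ⟨p, hp, hpH⟩
      exact Or.inr (hX.mono hXK)
  refine (isIndecomposable_subtype_iff (hX.mono subset_union_left)).2
    ⟨isConnected_union_singleton hX (isConnected_iff_connectedSpace.2 h.1) y,
      fun H K hH hK hHK ↦ ?_⟩
  rcases hHK.superset (Or.inr rfl : y ∈ X ∪ {y}) with hyH | hyK
  · exact hdense H K hH hHK hyH
  · exact (hdense K H hK ((union_comm K H).trans hHK) hyK).symm

end AbsorbingSubsets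

section MeagerComposants

variable {Y : Type*} [TopologicalSpace Y] {x y : Y}

theorem isNowhereDense_union_of_isClosed {A M : Set Y} (hA : IsNowhereDense A) (hM : IsClosed M)
    (hMn : IsNowhereDense M) : IsNowhereDense (A ∪ M) := by
  rw [IsNowhereDense, hM.closure_eq] at hMn
  rw [IsNowhereDense, closure_union, hM.closure_eq,
    interior_union_isClosed_of_interior_empty isClosed_closure hMn, hA]

theorem dense_of_dense_union {C M : Set Y} (hM : IsClosed M) (hMn : IsNowhereDense M)
    (h : Dense (C ∪ M)) : Dense C := by
  have hMc : Dense Mᶜ := (isClosed_isNowhereDense_iff_compl.1 ⟨hM, hMn⟩).2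
  refine (hMc.mono fun z hz ↦ ?_).of_closure
  have hzCM : z ∈ closure (C ∪ M) := h z
  rw [closure_union, hM.closure_eq] at hzCM
  exact hzCM.resolve_right hz

theorem subset_meagerComposant {K : Set Y} (hK : IsSubcontinuum K) (hKn : IsNowhereDense K)
    (hx : x ∈ K) : K ⊆ meagerComposant x :=
  subset_sUnion_of_mem ⟨hK, hKn, hx⟩

theorem isPreconnected_meagerComposant : IsPreconnected (meagerComposant x) :=
  isPreconnected_sUnion x _ (fun _ hK ↦ hK.2.2) fun _ hK ↦ hK.1.2.isPreconnected

theorem IsSubcontinuum.union {K M : Set Y} (hK : IsSubcontinuum K) (hM : IsSubcontinuum M)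
    (h : (K ∩ M).Nonempty) : IsSubcontinuum (K ∪ M) :=
  ⟨hK.1.union hM.1, hK.2.union h hM.2⟩

theorem absorbsNowhereDense_meagerComposant [T2Space Y] :
    AbsorbsNowhereDense (meagerComposant x) := by
  rintro L hL hLn - ⟨p, hpL, K, ⟨hK, hKn, hxK⟩, hpK⟩
  exact subset_union_right.trans (subset_meagerComposant (hK.union hL ⟨p, hpK, hpL⟩)
    (isNowhereDense_union_of_isClosed hKn hL.1.isClosed hLn) (Or.inl hxK))

theorem exists_isSubcontinuum_of_mem_meagerComposant [T2Space Y] {p q : Y}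
    (hp : p ∈ meagerComposant x) (hq : q ∈ meagerComposant x) :
    ∃ M ⊆ meagerComposant x, IsSubcontinuum M ∧ IsNowhereDense M ∧ p ∈ M ∧ q ∈ M := by
  obtain ⟨K, ⟨hK, hKn, hxK⟩, hpK⟩ := hp
  obtain ⟨M, ⟨hM, hMn, hxM⟩, hqM⟩ := hq
  have hKM : IsSubcontinuum (K ∪ M) := hK.union hM ⟨x, hxK, hxM⟩
  have hKMn : IsNowhereDense (K ∪ M) := isNowhereDense_union_of_isClosed hKn hM.1.isClosed hMn
  exact ⟨K ∪ M, subset_meagerComposant hKM hKMn (Or.inl hxK), hKM, hKMn, Or.inl hpK, Or.inr hqM⟩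

theorem IsIndecomposable.isMeagre_meagerComposant [T2Space Y] [SecondCountableTopology Y]
    (h : IsIndecomposable (meagerComposant x)) (hX : Dense (meagerComposant x)) :
    IsMeagre (meagerComposant x) := by
  obtain ⟨p, hp⟩ := (isConnected_iff_connectedSpace.2 h.1).nonempty
  let K : Set Y → Set Y := fun U ↦ connectedComponentIn (meagerComposant x \ U) p
  have hcover : meagerComposant x ⊆ ⋃ U ∈ countableBasis Y, K U := fun q hq ↦ by
    obtain ⟨M, hMX, hM, hMn, hpM, hqM⟩ := exists_isSubcontinuum_of_mem_meagerComposant hp hq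
    have : Nonempty Y := ⟨p⟩
    obtain ⟨z, hz⟩ := (isClosed_isNowhereDense_iff_compl.1 ⟨hM.1.isClosed, hMn⟩).2.nonempty
    obtain ⟨U, hU, -, hUM⟩ := (isBasis_countableBasis Y).exists_subset_of_mem_open hz
      hM.1.isClosed.isOpen_compl
    exact mem_iUnion₂.2 ⟨U, hU, hM.2.isPreconnected.subset_connectedComponentIn hpM
      (subset_sdiff.2 ⟨hMX, subset_compl_iff_disjoint_left.1 hUM⟩) hqM⟩
  refine (isMeagre_biUnion (countable_countableBasis Y)
    fun U hU ↦ IsNowhereDense.isMeagre ?_).mono hcover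
  by_contra hn
  have hKU : K U ⊆ meagerComposant x \ U := connectedComponentIn_subset _ _
  have hKne : (K U).Nonempty := nonempty_iff_ne_empty.2 fun hK ↦ hn (hK ▸ isNowhereDense_empty)
  obtain ⟨z, hzU, hzK⟩ := (h.dense_of_subset hX (hKU.trans sdiff_subset)
    ⟨hKne, isPreconnected_connectedComponentIn⟩ hn).inter_open_nonempty U
      (isOpen_of_mem_countableBasis hU) (nonempty_of_mem_countableBasis hU)
  exact (hKU hzK).2 hzU

theorem IsIndecomposable.nonempty_compl_meagerComposant [T2Space Y] [BaireSpace Y]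
    [SecondCountableTopology Y] (h : IsIndecomposable (meagerComposant x))
    (hX : Dense (meagerComposant x)) : (meagerComposant x)ᶜ.Nonempty := by
  obtain ⟨z⟩ := h.1.toNonempty
  have : Nonempty Y := ⟨z⟩
  exact (dense_of_mem_residual (h.isMeagre_meagerComposant hX)).nonempty

theorem IsIrreducibleConnected.exists_forall_dense [T2Space Y] (hX : Dense (meagerComposant x))
    (h : IsIrreducibleConnected ↥(meagerComposant x ∪ {y})) :
    ∃ p ∈ meagerComposant x, ∀ C ⊆ meagerComposant x ∪ {y}, IsConnected C → p ∈ C → y ∈ C →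
      Dense C := by
  have : Nonempty Y := ⟨y⟩
  obtain ⟨-, p, hp, q, hq, hpq⟩ :=
    (isIrreducibleConnected_subtype_iff (hX.mono subset_union_left)).1 h
  rcases hp with hp | rfl <;> rcases hq with hq | rfl
  · obtain ⟨M, hMX, hM, hMn, hpM, hqM⟩ := exists_isSubcontinuum_of_mem_meagerComposant hp hq
    have hMd : Dense M := hpq M (hMX.trans subset_union_left) hM.2 hpM hqM
    have hempty : Dense (∅ : Set Y) :=
      dense_of_dense_union hM.1.isClosed hMn (by rwa [empty_union])
    exact absurd hempty.nonempty not_nonempty_empty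
  · exact ⟨p, hp, hpq⟩
  · exact ⟨q, hq, fun C hCX hC hqC hpC ↦ hpq C hCX hC hpC hqC⟩
  · obtain ⟨p, hp⟩ := hX.nonempty
    exact ⟨p, hp, fun C hCX hC _ hqC ↦ hpq C hCX hC hqC hqC⟩

theorem IsIrreducibleConnected.isSingularWrt [T2Space Y] (hX : Dense (meagerComposant x))
    (h : IsIrreducibleConnected ↥(meagerComposant x ∪ {y})) :
    IsSingularWrt (meagerComposant x) y := by
  obtain ⟨p, hp, hpy⟩ := h.exists_forall_dense hX
  refine (isSingularWrt_iff hX).2 ⟨⟨⟨p, hp⟩, isPreconnected_meagerComposant⟩, ?_⟩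
  intro C hCX hC hyC
  obtain ⟨q, hq⟩ := hC.nonempty
  obtain ⟨M, hMX, hM, hMn, hpM, hqM⟩ := exists_isSubcontinuum_of_mem_meagerComposant hp (hCX hq)
  have hCM : IsConnected (C ∪ M) := hC.union ⟨q, hq, hqM⟩ hM.2
  have hyCM : y ∈ closure (C ∪ M) := closure_mono subset_union_left hyC
  have hinsert : Dense (insert y (C ∪ M)) :=
    hpy _ (insert_subset (Or.inr rfl) ((union_subset hCX hMX).trans subset_union_left))
      (hCM.subset_closure (subset_insert _ _) (insert_subset hyCM subset_closure))
      (Or.inr (Or.inr hpM)) (mem_insert _ _)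
  have hdense : Dense (C ∪ M) := (hinsert.mono (insert_subset hyCM subset_closure)).of_closure
  exact dense_of_dense_union hM.1.isClosed hMn hdense

end MeagerComposants

end ContinuumTheory

theorem proposition2p4 {Y : Type*} [TopologicalSpace Y] [CompactSpace Y] [ConnectedSpace Y]
    [TopologicalSpace.MetrizableSpace Y] [Nontrivial Y]
    (X : Set Y) (hX : ∃ x : Y, X = ContinuumTheory.meagerComposant x) (hdense : Dense X) :
    List.TFAE [
      ContinuumTheory.IsIndecomposable X,
      ContinuumTheory.IsStronglyIndecomposable X,
      ∃ y : Y, ContinuumTheory.IsSingularWrt X y,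
      Xᶜ.Nonempty ∧ ∀ y ∈ Xᶜ, ContinuumTheory.IsSingularWrt X y,
      ∃ y : Y, ContinuumTheory.IsIrreducibleConnected ↥(X ∪ {y}),
      Xᶜ.Nonempty ∧ ∀ y ∈ Xᶜ, ContinuumTheory.IsIrreducibleConnected ↥(X ∪ {y}),
      ∀ y : Y, ContinuumTheory.IsIndecomposable ↥(X ∪ {y})] := by
  obtain ⟨x, rfl⟩ := hX
  have : SecondCountableTopology Y :=
    letI := TopologicalSpace.metrizableSpaceMetric Y
    inferInstance
  have habs := ContinuumTheory.absorbsNowhereDense_meagerComposant (x := x)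
  tfae_have 1 → 2 := fun h ↦ h.isStronglyIndecomposable fun _ hC s ↦
    ContinuumTheory.isPreconnected_quasiComponent_of_isClosed habs hC s
  tfae_have 2 → 1 := fun h ↦ h.isIndecomposable
  tfae_have 1 → 4 := fun h ↦
    ⟨h.nonempty_compl_meagerComposant hdense, fun y hy ↦ h.isSingularWrt hdense habs hy⟩
  tfae_have 4 → 3 := fun ⟨⟨y, hy⟩, h⟩ ↦ ⟨y, h y hy⟩
  tfae_have 3 → 1 := fun ⟨_, h⟩ ↦ h.isIndecomposable hdense
  tfae_have 1 → 6 := fun h ↦ ⟨h.nonempty_compl_meagerComposant hdense,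
    fun y hy ↦ h.isIrreducibleConnected_union_singleton hdense habs hy⟩
  tfae_have 6 → 5 := fun ⟨⟨y, hy⟩, h⟩ ↦ ⟨y, h y hy⟩
  tfae_have 5 → 3 := fun ⟨y, h⟩ ↦ ⟨y, h.isSingularWrt hdense⟩
  tfae_have 1 → 7 := fun h y ↦ h.union_singleton hdense habs y
  tfae_have 7 → 1 := fun h ↦ by
    obtain ⟨y, hy⟩ := hdense.nonempty
    have hindec := h y
    rwa [Set.union_eq_left.2 (Set.singleton_subset_iff.2 hy)] at hindec
  tfae_finish
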